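/- Throughout, $\overline{X}$ denotes the convex hull in $\mathbb{R}^n$ of a set $X \subseteq \mathbb{R}^n$. For $x \in \mathbb{R}^n$ let $N(x) = \{ z \in \mathbb{Z}^n \mid |x_i - z_i| < 1 \ (i=1,\ldots,n) \}$. A nonempty set $S \subseteq \mathbb{Z}^n$ is called integrally convex if $\bigcup_{x \in \mathbb{R}^n} \overline{S \cap N(x)}$ is convex. A set $C \subseteq \mathbb{R}^n$ is a cone if $d \in C$ implies $\lambda d \in C$ for all real $\lambda \ge 0$; a set $G \subseteq \mathbb{Z}^n$ is conic if $\overline{G}$ is a cone. The characteristic cone of $P \subseteq \mathbb{R}^n$ is $\{ d \in \mathbb{R}^n \mid x + d \in P \text{ for all } x \in P \}$. **Theorem.** Every integrally convex set $S \subseteq \mathbb{Z}^n$ can be represented as a Minkowski sum $$ S = T + G = \{ t + g \mid t \in T,\ g \in G \} $$ with a bounded integrally convex set $T \subseteq \mathbb{Z}^n$ and a conic integrally convex set $G \subseteq \mathbb{Z}^n$. More precisely, one can take $G = C \cap \mathbb{Z}^n$, where $C$ is the characteristic cone of $\overline{S}$, and $T = S \cap B$ for some integral box $B = \{ x \in \mathbb{R}^n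 \mid l \le x \le u \}$ with $l, u \in \mathbb{Z}^n$, $l \le u$. -/

import Mathlib

open scoped Pointwise

namespace IntegralConvexity

/-- The inclusion of `ℤⁿ` into `ℝⁿ`. -/
def toReal {n : ℕ} (z : Fin n → ℤ) : Fin n → ℝ := fun i => (z i : ℝ)

/-- The convex hull, in `ℝⁿ`, of a set of integer points. -/
def hull {n : ℕ} (S : Set (Fin n → ℤ)) : Set (Fin n → ℝ) :=
  convexHull ℝ (toReal '' S)

/-- The integral neighborhood `N(x)` of a real vector `x`. -/
def integralNeighborhood {n : ℕ} (x : Fin n → ℝ) : Set (Fin n → ℤ) :=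
  {z | ∀ i, |x i - (z i : ℝ)| < 1}

/-- A set of integer points is integrally convex if it is nonempty and the union of its local
convex hulls `conv (S ∩ N(x))`, over all `x ∈ ℝⁿ`, is convex. -/
def IsIntegrallyConvex {n : ℕ} (S : Set (Fin n → ℤ)) : Prop :=
  S.Nonempty ∧ Convex ℝ (⋃ x : Fin n → ℝ, hull (S ∩ integralNeighborhood x))

/-- A cone in `ℝⁿ`: a set closed under multiplication by nonnegative reals. -/
def IsCone {n : ℕ} (C : Set (Fin n → ℝ)) : Prop :=
  ∀ d ∈ C, ∀ r : ℝ, 0 ≤ r → r • d ∈ C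

/-- A set of integer points is conic if its convex hull is a cone. -/
def IsConic {n : ℕ} (G : Set (Fin n → ℤ)) : Prop := IsCone (hull G)

/-- The characteristic (recession) cone of `P ⊆ ℝⁿ`. -/
def charCone {n : ℕ} (P : Set (Fin n → ℝ)) : Set (Fin n → ℝ) :=
  {d | ∀ x ∈ P, x + d ∈ P}

/-- The integer points `P ∩ ℤⁿ` of a set `P ⊆ ℝⁿ`. -/
def integerPoints {n : ℕ} (P : Set (Fin n → ℝ)) : Set (Fin n → ℤ) :=
  {z | toReal z ∈ P}

/-- The integral box `{x ∈ ℝⁿ | l ≤ x ≤ u}` with integer corners `l`, `u`. -/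
def integralBox {n : ℕ} (l u : Fin n → ℤ) : Set (Fin n → ℝ) :=
  Set.Icc (toReal l) (toReal u)

end IntegralConvexity

namespace IntegralConvexity

variable {n : ℕ}

/-! Integral convexity means that each point of `hull S` is a convex combination of points of `S`
near it. Hence the tangent cone at each `z ∈ S` is generated by vectors of `{-1, 0, 1}ⁿ`; only
finitely many such cones occur, and their intersection is the characteristic cone `C`.

Decomposition: if no finite part of `S` covered `S` by translates of `C`, there would be a sequence
in `S` with no later-minus-earlier difference in `C`. Dickson's lemma, applied to coefficients in
all tangent cones at once, contradicts this (`exists_finset_cover`). Any integral box around the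
finite cover then works.

Integral convexity of `C ∩ ℤⁿ`: by Krein–Milman it suffices that vertices `v` of `C ∩ B` are
integral for integral boxes `B` (`integral_of_mem_extremePoints`). Take `t ∈ S` extreme modulo `C -
ℝ₊v` and a point `y ∈ S` used to represent `t + v` locally. Then `v` can move both ways along `y -
(t + v)` inside `C ∩ B`, so this direction is zero and `v = y - t`. -/

theorem toReal_apply (z : Fin n → ℤ) (i : Fin n) : toReal z i = z i := rfl

theorem toReal_add (y z : Fin n → ℤ) : toReal (y + z) = toReal y + toReal z := by
  ext i; simp [toReal]

theorem toReal_sub (y z : Fin n → ℤ) : toReal (y - z) = toReal y - toReal z := by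
  ext i; simp [toReal]

theorem toReal_zero : toReal (0 : Fin n → ℤ) = 0 := by
  ext i; simp [toReal]

theorem toReal_nsmul (k : ℕ) (z : Fin n → ℤ) : toReal (k • z) = (k : ℝ) • toReal z := by
  ext i; simp [toReal]

theorem toReal_injective : Function.Injective (toReal (n := n)) := by
  intro y z h
  ext i
  have : (y i : ℝ) = z i := congrFun h i
  exact_mod_cast this

/-! ### Convex hulls of sets of integer points -/

theorem convex_hull (A : Set (Fin n → ℤ)) : Convex ℝ (hull A) := convex_convexHull ℝ _

theorem subset_hull {A : Set (Fin n → ℤ)} {z : Fin n → ℤ} (hz : z ∈ A) : toReal z ∈ hull A :=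
  subset_convexHull ℝ _ ⟨z, hz, rfl⟩

theorem hull_mono {A B : Set (Fin n → ℤ)} (h : A ⊆ B) : hull A ⊆ hull B :=
  convexHull_mono (Set.image_mono h)

theorem hull_subset_of_convex {A : Set (Fin n → ℤ)} {K : Set (Fin n → ℝ)} (hK : Convex ℝ K)
    (h : ∀ z ∈ A, toReal z ∈ K) : hull A ⊆ K := by
  refine convexHull_min ?_ hK
  rintro _ ⟨z, hz, rfl⟩
  exact h z hz

theorem sum_mem_hull {A : Set (Fin n → ℤ)} (F : Finset (Fin n → ℤ)) (w : (Fin n → ℤ) → ℝ)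
    (h0 : ∀ z ∈ F, 0 ≤ w z) (h1 : ∑ z ∈ F, w z = 1) (hF : ∀ z ∈ F, z ∈ A) :
    ∑ z ∈ F, w z • toReal z ∈ hull A :=
  (convex_hull A).sum_mem h0 h1 fun z hz => subset_hull (hF z hz)

/-- Points of the hull are convex combinations with positive weights. -/
theorem exists_weights_of_mem_hull {A : Set (Fin n → ℤ)} {x : Fin n → ℝ} (hx : x ∈ hull A) :
    ∃ (F : Finset (Fin n → ℤ)) (w : (Fin n → ℤ) → ℝ), (∀ z ∈ F, z ∈ A) ∧ (∀ z ∈ F, 0 < w z) ∧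
      ∑ z ∈ F, w z = 1 ∧ ∑ z ∈ F, w z • toReal z = x := by
  classical
  rw [hull, convexHull_eq_union_convexHull_finite_subsets] at hx
  simp only [Set.mem_iUnion] at hx
  obtain ⟨t, ht, hx⟩ := hx
  obtain ⟨F, hF, rfl⟩ := Finset.subset_set_image_iff.1 ht
  rw [Finset.mem_convexHull'] at hx
  obtain ⟨w, h0, h1, h2⟩ := hx
  rw [Finset.sum_image toReal_injective.injOn] at h1 h2
  refine ⟨F.filter fun z => w (toReal z) ≠ 0, fun z => w (toReal z), ?_, ?_, ?_, ?_⟩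
  · intro z hz
    exact hF (Finset.mem_filter.1 hz).1
  · intro z hz
    obtain ⟨hz, hw⟩ := Finset.mem_filter.1 hz
    exact lt_of_le_of_ne (h0 _ (Finset.mem_image_of_mem _ hz)) hw.symm
  · rw [Finset.sum_filter_ne_zero, h1]
  · rw [← h2]
    refine Finset.sum_filter_of_ne fun z _ hz h => hz ?_
    simp [h]

/-! ### Local representation of points of the hull -/

theorem mem_integralNeighborhood_toReal {y z : Fin n → ℤ} :
    y ∈ integralNeighborhood (toReal z) ↔ y = z := by
  constructor
  · intro h
    ext i
    have := h i
    rw [toReal_apply] at this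
    have : |z i - y i| < 1 := by exact_mod_cast this
    rw [abs_lt] at this
    omega
  · rintro rfl i
    simp [toReal_apply]

/-- A local convex combination is local around the point that it represents. -/
theorem mem_hull_inter_self {A : Set (Fin n → ℤ)} {x y : Fin n → ℝ}
    (hx : x ∈ hull (A ∩ integralNeighborhood y)) : x ∈ hull (A ∩ integralNeighborhood x) := by
  obtain ⟨F, w, hF, h0, h1, h2⟩ := exists_weights_of_mem_hull hx
  rw [← h2]
  refine sum_mem_hull F w (fun z hz => (h0 z hz).le) h1 fun z hz => ⟨(hF z hz).1, fun i => ?_⟩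
  have e : (∑ z ∈ F, w z • toReal z) i - z i = ∑ v ∈ F, w v * ((v i : ℝ) - z i) := by
    simp only [mul_sub, Finset.sum_sub_distrib, ← Finset.sum_mul, h1, one_mul]
    simp [Finset.sum_apply, toReal_apply]
  rw [e]
  calc |∑ v ∈ F, w v * ((v i : ℝ) - z i)| ≤ ∑ v ∈ F, |w v * ((v i : ℝ) - z i)| :=
        Finset.abs_sum_le_sum_abs _ _
    _ < ∑ v ∈ F, w v := by
        -- Integers at distance less than 1 from the same `y i` differ by at most 1. The term `v =
        -- z` vanishes, which makes the inequality strict.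
        refine Finset.sum_lt_sum (fun v hv => ?_) ⟨z, hz, ?_⟩
        · rw [abs_mul, abs_of_pos (h0 v hv)]
          refine mul_le_of_le_one_right (h0 v hv).le ?_
          have a := abs_lt.1 ((hF v hv).2 i)
          have b := abs_lt.1 ((hF z hz).2 i)
          have c1 : (v i : ℝ) < z i + 2 := by linarith
          have c2 : (z i : ℝ) < v i + 2 := by linarith
          have c3 : v i < z i + 2 := by exact_mod_cast c1
          have c4 : z i < v i + 2 := by exact_mod_cast c2
          have : |v i - z i| ≤ 1 := abs_le.2 ⟨by omega, by omega⟩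
          exact_mod_cast this
        · simpa using h0 z hz
    _ = 1 := h1

theorem IsIntegrallyConvex.mem_local {S : Set (Fin n → ℤ)} (hS : IsIntegrallyConvex S)
    {x : Fin n → ℝ} (hx : x ∈ hull S) : x ∈ hull (S ∩ integralNeighborhood x) := by
  have : x ∈ ⋃ x : Fin n → ℝ, hull (S ∩ integralNeighborhood x) := by
    refine hull_subset_of_convex hS.2 (fun z hz => ?_) hx
    exact Set.mem_iUnion.2 ⟨toReal z, subset_hull ⟨hz, mem_integralNeighborhood_toReal.2 rfl⟩⟩
  obtain ⟨y, hy⟩ := Set.mem_iUnion.1 this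
  exact mem_hull_inter_self hy

theorem isIntegrallyConvex_of_local {S : Set (Fin n → ℤ)} (hne : S.Nonempty)
    (h : ∀ x ∈ hull S, x ∈ hull (S ∩ integralNeighborhood x)) : IsIntegrallyConvex S := by
  refine ⟨hne, ?_⟩
  have : (⋃ x : Fin n → ℝ, hull (S ∩ integralNeighborhood x)) = hull S := by
    refine Set.Subset.antisymm (Set.iUnion_subset fun x => hull_mono Set.inter_subset_left) ?_
    exact fun x hx => Set.mem_iUnion.2 ⟨x, h x hx⟩
  rw [this]
  exact convex_hull S

theorem IsIntegrallyConvex.mem_of_toReal_mem_hull {S : Set (Fin n → ℤ)}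
    (hS : IsIntegrallyConvex S) {z : Fin n → ℤ} (hz : toReal z ∈ hull S) : z ∈ S := by
  obtain ⟨_, y, hy, -⟩ : (toReal '' (S ∩ integralNeighborhood (toReal z))).Nonempty :=
    (convexHull_nonempty_iff (𝕜 := ℝ)).1 ⟨_, hS.mem_local hz⟩
  exact mem_integralNeighborhood_toReal.1 hy.2 ▸ hy.1

/-! ### Integral boxes and closedness of the hull -/

theorem mem_box_of_mem_integralNeighborhood {l u z : Fin n → ℤ} {x : Fin n → ℝ}
    (hx : x ∈ integralBox l u) (hz : z ∈ integralNeighborhood x) :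
    toReal z ∈ integralBox l u := by
  constructor <;> intro i
  · have a := abs_lt.1 (hz i)
    have b := hx.1 i
    simp only [toReal_apply] at b ⊢
    have : (l i : ℝ) < z i + 1 := by linarith
    have : l i < z i + 1 := by exact_mod_cast this
    exact_mod_cast Int.lt_add_one_iff.1 this
  · have a := abs_lt.1 (hz i)
    have b := hx.2 i
    simp only [toReal_apply] at b ⊢
    have : (z i : ℝ) < u i + 1 := by linarith
    have : z i < u i + 1 := by exact_mod_cast this
    exact_mod_cast Int.lt_add_one_iff.1 this

theorem IsIntegrallyConvex.mem_hull_inter_box {S : Set (Fin n → ℤ)} (hS : IsIntegrallyConvex S)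
    {l u : Fin n → ℤ} {x : Fin n → ℝ} (hx : x ∈ hull S) (hb : x ∈ integralBox l u) :
    x ∈ hull (S ∩ integerPoints (integralBox l u) ∩ integralNeighborhood x) := by
  refine hull_mono ?_ (hS.mem_local hx)
  rintro z ⟨hz, hzx⟩
  exact ⟨⟨hz, mem_box_of_mem_integralNeighborhood hb hzx⟩, hzx⟩

theorem IsIntegrallyConvex.inter_box {S : Set (Fin n → ℤ)} (hS : IsIntegrallyConvex S)
    {l u : Fin n → ℤ} (hne : (S ∩ integerPoints (integralBox l u)).Nonempty) :
    IsIntegrallyConvex (S ∩ integerPoints (integralBox l u)) := by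
  refine isIntegrallyConvex_of_local hne fun x hx => ?_
  refine hS.mem_hull_inter_box (hull_mono Set.inter_subset_left hx) ?_
  exact hull_subset_of_convex (convex_Icc _ _) (fun z hz => hz.2) hx

theorem integerPoints_box_eq (l u : Fin n → ℤ) :
    integerPoints (integralBox l u) = Set.Icc l u := by
  ext z
  simp only [integerPoints, integralBox, Set.mem_ofPred_eq, Set.mem_Icc, Pi.le_def, toReal_apply,
    Int.cast_le]

/-- The hull of an integrally convex set is closed. -/
theorem IsIntegrallyConvex.isClosed_hull {S : Set (Fin n → ℤ)} (hS : IsIntegrallyConvex S) :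
    IsClosed (hull S) := by
  rw [← closure_subset_iff_isClosed]
  intro x hx
  -- The margin 1 makes the box a neighborhood of `x`; inside it the hull is that of finitely many
  -- points.
  set l : Fin n → ℤ := fun i => ⌊x i⌋ - 1
  set u : Fin n → ℤ := fun i => ⌈x i⌉ + 1
  have hnhds : integralBox l u ∈ nhds x := by
    have : integralBox l u = Set.univ.pi fun i => Set.Icc (toReal l i) (toReal u i) :=
      (Set.pi_univ_Icc _ _).symm
    rw [this]
    refine set_pi_mem_nhds Set.finite_univ fun i _ => Icc_mem_nhds ?_ ?_
    · simp only [toReal_apply, l]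
      push_cast
      linarith [Int.floor_le (x i)]
    · simp only [toReal_apply, u]
      push_cast
      linarith [Int.le_ceil (x i)]
  have hcl : IsClosed (hull (S ∩ integerPoints (integralBox l u))) := by
    refine Set.Finite.isClosed_convexHull ℝ (Set.Finite.image _ ?_)
    rw [integerPoints_box_eq]
    exact (Set.finite_Icc l u).inter_of_right S
  have : x ∈ closure (hull S ∩ integralBox l u) :=
    (mem_closure_iff_nhds.2 fun t ht => by
      obtain ⟨y, hy, hyS⟩ := mem_closure_iff_nhds.1 hx _ (Filter.inter_mem ht hnhds)
      exact ⟨y, hy.1, hyS, hy.2⟩)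
  have hsub : hull S ∩ integralBox l u ⊆ hull (S ∩ integerPoints (integralBox l u)) :=
    fun y hy => hull_mono Set.inter_subset_left (hS.mem_hull_inter_box hy.1 hy.2)
  exact hull_mono Set.inter_subset_left (closure_minimal hsub hcl this)

/-! ### Characteristic cones -/

theorem zero_mem_charCone (P : Set (Fin n → ℝ)) : (0 : Fin n → ℝ) ∈ charCone P := fun x hx => by
  simpa using hx

theorem add_mem_charCone {P : Set (Fin n → ℝ)} {c d : Fin n → ℝ} (hc : c ∈ charCone P)
    (hd : d ∈ charCone P) : c + d ∈ charCone P := fun x hx => by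
  rw [← add_assoc]
  exact hd _ (hc _ hx)

theorem nsmul_mem_charCone {P : Set (Fin n → ℝ)} {d : Fin n → ℝ} (hd : d ∈ charCone P) (k : ℕ) :
    (k : ℝ) • d ∈ charCone P := by
  induction k with
  | zero => simpa using zero_mem_charCone P
  | succ k ih =>
    rw [Nat.cast_succ, add_smul, one_smul]
    exact add_mem_charCone ih hd

/-- Iterating the translation gives natural multiples; convexity of `P` interpolates between them,
so closedness is not needed. -/
theorem smul_mem_charCone {P : Set (Fin n → ℝ)} (hP : Convex ℝ P) {d : Fin n → ℝ}
    (hd : d ∈ charCone P) {r : ℝ} (hr : 0 ≤ r) : r • d ∈ charCone P := fun x hx => by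
  rcases hr.eq_or_lt with rfl | hr
  · simpa using hx
  obtain ⟨k, hk⟩ := exists_nat_gt r
  have hk0 : (0 : ℝ) < k := hr.trans hk
  have := hP.add_smul_mem hx (nsmul_mem_charCone hd k x hx) (t := r / k)
    ⟨by positivity, (div_le_one hk0).2 hk.le⟩
  rwa [smul_smul, div_mul_cancel₀ _ hk0.ne'] at this

theorem convex_charCone {P : Set (Fin n → ℝ)} (hP : Convex ℝ P) : Convex ℝ (charCone P) :=
  fun _ hc _ hd _ _ ha hb _ =>
    add_mem_charCone (smul_mem_charCone hP hc ha) (smul_mem_charCone hP hd hb)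

theorem isClosed_charCone {P : Set (Fin n → ℝ)} (hP : IsClosed P) : IsClosed (charCone P) := by
  have : charCone P = ⋂ x ∈ P, (fun d => x + d) ⁻¹' P := by
    ext d; simp [charCone]
  rw [this]
  exact isClosed_biInter fun x _ => hP.preimage (by fun_prop)

/-- A translation that maps a set of integer points into its hull maps the hull into itself. -/
theorem mem_charCone_hull_iff {A : Set (Fin n → ℤ)} {d : Fin n → ℝ} :
    d ∈ charCone (hull A) ↔ ∀ z ∈ A, toReal z + d ∈ hull A := by
  refine ⟨fun h z hz => h _ (subset_hull hz), fun h x hx => ?_⟩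
  have hc : Convex ℝ ((fun x => x + d) ⁻¹' hull A) := (convex_hull A).translate_preimage_left d
  exact hull_subset_of_convex hc h hx

/-- The integer points of a characteristic cone form a conic set. -/
theorem isConic_integerPoints_charCone (P : Set (Fin n → ℝ)) :
    IsConic (integerPoints (charCone P)) := by
  intro d hd r hr
  have hc : Convex ℝ ((fun x => r • x) ⁻¹' hull (integerPoints (charCone P))) :=
    (convex_hull _).is_linear_preimage (IsLinearMap.isLinearMap_smul r)
  refine hull_subset_of_convex hc (fun z hz => ?_) hd
  obtain ⟨k, hk⟩ := exists_nat_gt r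
  have hk0 : (0 : ℝ) < k := hr.trans_lt hk
  have h0 : (0 : Fin n → ℝ) ∈ hull (integerPoints (charCone P)) := by
    rw [← toReal_zero]
    refine subset_hull ?_
    change toReal 0 ∈ charCone P
    rw [toReal_zero]
    exact zero_mem_charCone P
  have hk1 : (k : ℝ) • toReal z ∈ hull (integerPoints (charCone P)) := by
    rw [← toReal_nsmul]
    refine subset_hull ?_
    change toReal _ ∈ charCone P
    rw [toReal_nsmul]
    exact nsmul_mem_charCone hz k
  have := (convex_hull _).smul_mem_of_zero_mem h0 hk1 (t := r / k)
    ⟨by positivity, (div_le_one hk0).2 hk.le⟩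
  rwa [smul_smul, div_mul_cancel₀ _ hk0.ne'] at this

/-! ### Tangent cones and local directions -/

/-- The directions `e ∈ {-1, 0, 1}ⁿ` with `z + e ∈ S`. -/
noncomputable def localDirections (S : Set (Fin n → ℤ)) (z : Fin n → ℤ) : Finset (Fin n → ℤ) :=
  open scoped Classical in (Finset.Icc (-1) 1).filter fun e => z + e ∈ S

/-- The cone generated by a finite set of integer vectors. -/
def generatedCone (D : Finset (Fin n → ℤ)) : Set (Fin n → ℝ) :=
  {d | ∃ c : (Fin n → ℤ) → ℝ, (∀ e ∈ D, 0 ≤ c e) ∧ ∑ e ∈ D, c e • toReal e = d}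

theorem mem_localDirections {S : Set (Fin n → ℤ)} {z e : Fin n → ℤ} :
    e ∈ localDirections S z ↔ (-1 ≤ e ∧ e ≤ 1) ∧ z + e ∈ S := by
  simp [localDirections]

theorem smul_mem_generatedCone {D : Finset (Fin n → ℤ)} {d : Fin n → ℝ}
    (hd : d ∈ generatedCone D) {r : ℝ} (hr : 0 ≤ r) : r • d ∈ generatedCone D := by
  obtain ⟨c, hc, rfl⟩ := hd
  exact ⟨fun e => r * c e, fun e he => mul_nonneg hr (hc e he), by
    simp only [Finset.smul_sum, smul_smul]⟩

theorem convex_generatedCone (D : Finset (Fin n → ℤ)) : Convex ℝ (generatedCone D) := by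
  rintro x hx y hy a b ha hb -
  obtain ⟨c, hc, hcx⟩ := smul_mem_generatedCone hx ha
  obtain ⟨c', hc', hcy⟩ := smul_mem_generatedCone hy hb
  refine ⟨fun e => c e + c' e, fun e he => add_nonneg (hc e he) (hc' e he), ?_⟩
  simp only [add_smul, Finset.sum_add_distrib, hcx, hcy]

theorem mem_generatedCone_of_mem {D : Finset (Fin n → ℤ)} {e : Fin n → ℤ} (he : e ∈ D) :
    toReal e ∈ generatedCone D := by
  refine ⟨fun v => if v = e then 1 else 0, fun v _ => ?_, ?_⟩
  · dsimp only
    split_ifs <;> norm_num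
  · simp [ite_smul, he]

/-- An integrally convex set lies in its tangent cone at each of its points, and this cone is
generated by the local directions. -/
theorem IsIntegrallyConvex.sub_mem_generatedCone {S : Set (Fin n → ℤ)}
    (hS : IsIntegrallyConvex S) {z : Fin n → ℤ} (hz : z ∈ S) {x : Fin n → ℝ} (hx : x ∈ hull S) :
    x - toReal z ∈ generatedCone (localDirections S z) := by
  -- Scaling by `M⁻¹` brings `p` within sup-distance less than 1 of `z`, so the integer points near
  -- `p` differ from `z` by vectors of `{-1, 0, 1}ⁿ`.
  set M : ℝ := ‖x - toReal z‖ + 1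
  have hM : 0 < M := by positivity
  set p : Fin n → ℝ := toReal z + M⁻¹ • (x - toReal z)
  have hp : p ∈ hull S := (convex_hull S).add_smul_sub_mem (subset_hull hz) hx
    ⟨by positivity, inv_le_one_of_one_le₀ (by simp [M])⟩
  have hpz : ∀ i, |p i - z i| < 1 := fun i => by
    have : p i - z i = M⁻¹ * (x - toReal z) i := by
      simp [p, toReal_apply]
    rw [this, abs_mul, abs_of_pos (inv_pos.2 hM), inv_mul_lt_iff₀ hM, mul_one]
    have := norm_le_pi_norm (x - toReal z) i
    rw [Real.norm_eq_abs] at this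
    simp only [M]
    linarith
  have key : p - toReal z ∈ generatedCone (localDirections S z) := by
    have hc : Convex ℝ ((fun q => q + -toReal z) ⁻¹' generatedCone (localDirections S z)) :=
      (convex_generatedCone _).translate_preimage_left _
    rw [sub_eq_add_neg]
    refine hull_subset_of_convex hc (fun y hy => ?_) (hS.mem_local hp)
    change toReal y + -toReal z ∈ generatedCone (localDirections S z)
    rw [← sub_eq_add_neg, ← toReal_sub]
    refine mem_generatedCone_of_mem (mem_localDirections.2 ⟨?_, by simpa using hy.1⟩)
    have : ∀ i, -1 ≤ y i - z i ∧ y i - z i ≤ 1 := fun i => by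
      have a := abs_lt.1 (hy.2 i)
      have b := abs_lt.1 (hpz i)
      have c1 : (y i : ℝ) < z i + 2 := by linarith
      have c2 : (z i : ℝ) < y i + 2 := by linarith
      have c3 : y i < z i + 2 := by exact_mod_cast c1
      have c4 : z i < y i + 2 := by exact_mod_cast c2
      omega
    exact ⟨fun i => (this i).1, fun i => (this i).2⟩
  have := smul_mem_generatedCone key hM.le
  rwa [show p - toReal z = M⁻¹ • (x - toReal z) by simp [p], smul_smul, mul_inv_cancel₀ hM.ne',
    one_smul] at this

/-- Once `k` exceeds the sum of the coefficients of `d`, the vector `d / k` is a convex combination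
of `0` and `D`. The threshold does not depend on the base point, which allows a common step length
later. -/
theorem exists_nat_add_smul_mem_hull {D : Finset (Fin n → ℤ)} {d : Fin n → ℝ}
    (hd : d ∈ generatedCone D) :
    ∃ m : ℕ, ∀ k : ℕ, m ≤ k → ∀ (A : Set (Fin n → ℤ)) (z : Fin n → ℤ), z ∈ A →
      (∀ e ∈ D, z + e ∈ A) → toReal z + (k : ℝ)⁻¹ • d ∈ hull A := by
  obtain ⟨c, hc, rfl⟩ := hd
  obtain ⟨m, hm⟩ := exists_nat_gt (∑ e ∈ D, c e)
  refine ⟨m, fun k hk A z hz hD => ?_⟩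
  have hs0 : 0 ≤ ∑ e ∈ D, c e := Finset.sum_nonneg hc
  have hmk : (m : ℝ) ≤ k := by exact_mod_cast hk
  have hk0 : (0 : ℝ) < k := (hs0.trans_lt hm).trans_le hmk
  set K : Set (Fin n → ℝ) := (fun v => toReal z + v) ⁻¹' hull A
  have hK : Convex ℝ K := (convex_hull A).translate_preimage_right _
  have h0 : (0 : Fin n → ℝ) ∈ K := by
    change toReal z + 0 ∈ hull A
    simpa using subset_hull hz
  change (k : ℝ)⁻¹ • ∑ e ∈ D, c e • toReal e ∈ K
  rcases hs0.eq_or_lt with h | h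
  · have : ∑ e ∈ D, c e • toReal e = 0 := Finset.sum_eq_zero fun e he => by
      rw [(Finset.sum_eq_zero_iff_of_nonneg hc).1 h.symm e he, zero_smul]
    rwa [this, smul_zero]
  · have hcm : D.centerMass c toReal ∈ K := hK.centerMass_mem hc h fun e he => by
      change toReal z + toReal e ∈ hull A
      rw [← toReal_add]
      exact subset_hull (hD e he)
    have := hK.smul_mem_of_zero_mem h0 hcm (t := (∑ e ∈ D, c e) / k)
      ⟨by positivity, (div_le_one hk0).2 (hm.le.trans hmk)⟩
    rwa [Finset.centerMass, smul_smul, div_mul_eq_mul_div, mul_inv_cancel₀ h.ne', one_div] at this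

/-- The characteristic cone is the intersection of the tangent cones. -/
theorem mem_charCone_of_mem_generatedCone {S : Set (Fin n → ℤ)} {d : Fin n → ℝ}
    (h : ∀ z ∈ S, d ∈ generatedCone (localDirections S z)) : d ∈ charCone (hull S) := by
  classical
  have hm : ∀ D : Finset (Fin n → ℤ), ∃ m : ℕ, d ∈ generatedCone D →
      ∀ k : ℕ, m ≤ k → ∀ (A : Set (Fin n → ℤ)) (z : Fin n → ℤ), z ∈ A →
        (∀ e ∈ D, z + e ∈ A) → toReal z + (k : ℝ)⁻¹ • d ∈ hull A := fun D => by
    by_cases hD : d ∈ generatedCone D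
    · obtain ⟨m, hm⟩ := exists_nat_add_smul_mem_hull hD
      exact ⟨m, fun _ => hm⟩
    · exact ⟨0, fun h => absurd h hD⟩
  choose m hm using hm
  -- One step length `1 / k` serves every `z ∈ S`, since there are finitely many possible direction
  -- sets; `+ 1` keeps `k` positive.
  set k : ℕ := (Finset.Icc (-1 : Fin n → ℤ) 1).powerset.sup m + 1
  have key : (k : ℝ)⁻¹ • d ∈ charCone (hull S) := by
    refine mem_charCone_hull_iff.2 fun z hz => ?_
    refine hm (localDirections S z) (h z hz) k ?_ S z hz fun e he => (mem_localDirections.1 he).2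
    exact (Finset.le_sup (f := m) (Finset.mem_powerset.2 (Finset.filter_subset _ _))).trans
      (Nat.le_succ _)
  have := nsmul_mem_charCone key k
  rwa [smul_smul, mul_inv_cancel₀ (by positivity), one_smul] at this

/-! ### Finite covers by translates of the characteristic cone -/

/-- An integer point of a cone generated by vectors in `{-1, 0, 1}ⁿ` is a nonnegative integer
combination of the generators, up to a remainder in a fixed box. -/
theorem exists_floor_remainder {D : Finset (Fin n → ℤ)} (hD : D ⊆ Finset.Icc (-1) 1)
    {y : Fin n → ℤ} (hy : toReal y ∈ generatedCone D) :
    ∃ (a : Finset.Icc (-1 : Fin n → ℤ) 1 → ℕ)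
      (f : Set.Icc (fun _ : Fin n => -((Finset.Icc (-1 : Fin n → ℤ) 1).card : ℤ))
        (fun _ => ((Finset.Icc (-1 : Fin n → ℤ) 1).card : ℤ))),
      y = ∑ e ∈ D.attach, a ⟨e, hD e.2⟩ • e.1 + f := by
  obtain ⟨c, hc, h⟩ := hy
  set r : Fin n → ℤ := y - ∑ e ∈ D, ⌊c e⌋₊ • e
  have hr : ∀ i, |r i| ≤ ((Finset.Icc (-1 : Fin n → ℤ) 1).card : ℤ) := fun i => by
    have e1 : ((r i : ℤ) : ℝ) = ∑ e ∈ D, (c e - ⌊c e⌋₊) * (e i : ℝ) := by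
      have := congrFun h i
      simp only [Finset.sum_apply, Pi.smul_apply, smul_eq_mul, toReal_apply] at this
      simp [r, sub_mul, this]
    have e2 : |((r i : ℤ) : ℝ)| ≤ D.card := by
      rw [e1]
      refine (Finset.abs_sum_le_sum_abs _ _).trans ?_
      rw [Finset.card_eq_sum_ones, Nat.cast_sum]
      refine Finset.sum_le_sum fun e he => ?_
      rw [abs_mul]
      have h1 : |c e - ⌊c e⌋₊| ≤ 1 := by
        rw [abs_le]
        have := Nat.floor_le (hc e he)
        have := Nat.lt_floor_add_one (c e)
        constructor <;> linarith
      have h2 : |(e i : ℝ)| ≤ 1 := by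
        have := Finset.mem_Icc.1 (hD he)
        have : |e i| ≤ 1 := abs_le.2 ⟨this.1 i, this.2 i⟩
        exact_mod_cast this
      simpa using mul_le_one₀ h1 (abs_nonneg _) h2
    have e3 : |r i| ≤ (D.card : ℤ) := by exact_mod_cast e2
    exact e3.trans (by exact_mod_cast Finset.card_le_card hD)
  refine ⟨fun e => ⌊c e⌋₊, ⟨r, fun i => (abs_le.1 (hr i)).1, fun i => (abs_le.1 (hr i)).2⟩, ?_⟩
  rw [Finset.sum_attach D fun e => ⌊c e⌋₊ • e]
  simp [r]

/-- An integrally convex set is covered by finitely many translates of its characteristic cone. -/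
theorem IsIntegrallyConvex.exists_finset_cover {S : Set (Fin n → ℤ)}
    (hS : IsIntegrallyConvex S) :
    ∃ T : Finset (Fin n → ℤ), (∀ t ∈ T, t ∈ S) ∧
      ∀ s ∈ S, ∃ t ∈ T, toReal (s - t) ∈ charCone (hull S) := by
  classical
  by_contra! hT
  obtain ⟨s, hsS, hs⟩ := exists_seq_of_forall_finset_exists (· ∈ S)
    (fun t s => toReal (s - t) ∉ charCone (hull S)) hT
  set I := ↥(localDirections S '' S)
  have hI : Finite I := by
    refine Set.Finite.subset (Finset.finite_toSet (Finset.Icc (-1 : Fin n → ℤ) 1).powerset) ?_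
    rintro _ ⟨z, -, rfl⟩
    exact Finset.mem_coe.2 (Finset.mem_powerset.2 (Finset.filter_subset _ _))
  have hsub : ∀ i : I, i.1 ⊆ Finset.Icc (-1 : Fin n → ℤ) 1 := by
    rintro ⟨_, z, -, rfl⟩
    exact Finset.filter_subset _ _
  have hrep : ∀ i : I, ∃ z ∈ S, localDirections S z = i.1 := fun i => i.2
  choose z hz hzi using hrep
  have hdec : ∀ (k : ℕ) (i : I), toReal (s k - z i) ∈ generatedCone i.1 := fun k i => by
    rw [toReal_sub, ← hzi i]
    exact hS.sub_mem_generatedCone (hz i) (subset_hull (hsS k))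
  choose a f haf using fun k i => exists_floor_remainder (hsub i) (hdec k i)
  -- Dickson's lemma orders the coefficients; the remainders take finitely many values and can be
  -- required to agree.
  have hw := WellQuasiOrdered.prod
    (wellQuasiOrdered_le (α := I → Finset.Icc (-1 : Fin n → ℤ) 1 → ℕ))
    (Finite.wellQuasiOrdered (α := I → Set.Icc
      (fun _ : Fin n => -((Finset.Icc (-1 : Fin n → ℤ) 1).card : ℤ))
      (fun _ => ((Finset.Icc (-1 : Fin n → ℤ) 1).card : ℤ))) (· = ·))
  obtain ⟨j, k, hjk, h⟩ := hw fun k => (a k, f k)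
  refine hs j k hjk (mem_charCone_of_mem_generatedCone fun y hy => ?_)
  set i : I := ⟨localDirections S y, y, hy, rfl⟩
  have hai : a j i ≤ a k i := h.1 i
  have hfi : f j i = f k i := congrFun h.2 i
  refine ⟨fun e => if he : e ∈ i.1 then
    (a k i ⟨e, hsub i he⟩ : ℝ) - a j i ⟨e, hsub i he⟩ else 0, fun e he => ?_, ?_⟩
  · have he : e ∈ i.1 := he
    dsimp only
    rw [dif_pos he, sub_nonneg]
    exact_mod_cast hai _
  · change ∑ e ∈ i.1, _ = _
    have e1 : s k - s j = (s k - z i) - (s j - z i) := by abel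
    rw [e1, haf k i, haf j i, hfi, add_sub_add_right_eq_sub, ← Finset.sum_attach i.1]
    ext v
    simp [toReal_apply, sub_mul]

/-! ### Extreme points modulo a cone -/

theorem hull_insert {A : Set (Fin n → ℤ)} (hA : A.Nonempty) {t : Fin n → ℤ} {x : Fin n → ℝ}
    (hx : x ∈ hull (insert t A)) :
    ∃ p ∈ hull A, ∃ a : ℝ, 0 ≤ a ∧ x = toReal t + a • (p - toReal t) := by
  rw [hull, Set.image_insert_eq, convexHull_insert (hA.image _), mem_convexJoin] at hx
  obtain ⟨_, rfl, p, hp, hx⟩ := hx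
  rw [segment_eq_image'] at hx
  obtain ⟨a, ha, rfl⟩ := hx
  exact ⟨p, hp, a, ha.1, rfl⟩

/-- If finitely many translates of a convex cone `Q` cover `S`, then some `t ∈ S` is extreme in
`hull S` modulo `Q`. -/
theorem exists_extreme_modulo_cone {S : Set (Fin n → ℤ)} (hne : S.Nonempty)
    {Q : Set (Fin n → ℝ)} (h0 : (0 : Fin n → ℝ) ∈ Q)
    (hadd : ∀ q ∈ Q, ∀ q' ∈ Q, q + q' ∈ Q) (hsmul : ∀ q ∈ Q, ∀ r : ℝ, 0 ≤ r → r • q ∈ Q)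
    {T₀ : Finset (Fin n → ℤ)} (hT₀ : ∀ t ∈ T₀, t ∈ S)
    (hcov : ∀ s ∈ S, ∃ t ∈ T₀, toReal (s - t) ∈ Q) :
    ∃ t ∈ S, ∀ v d, -v ∈ Q → toReal t + v + d ∈ hull S → toReal t + v - d ∈ hull S →
      d ∈ Q ∧ -d ∈ Q := by
  classical
  have hQ : Convex ℝ Q := fun x hx y hy a b ha hb _ =>
    hadd _ (hsmul x hx a ha) _ (hsmul y hy b hb)
  have hconv : ∀ A : Set (Fin n → ℤ), Convex ℝ (hull A + Q) := fun A => (convex_hull A).add hQ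
  -- `T` is minimal with `S ⊆ hull T + Q`; any element of it will do as `t`.
  obtain ⟨T, ⟨hTS, hT⟩, hmin⟩ := (wellFounded_lt (α := Finset (Fin n → ℤ))).has_min
    {T | (∀ t ∈ T, t ∈ S) ∧ ∀ s ∈ S, toReal s ∈ hull (T : Set (Fin n → ℤ)) + Q} ⟨T₀, hT₀, by
      intro s hs
      obtain ⟨t, ht, hq⟩ := hcov s hs
      exact Set.mem_add.2
        ⟨toReal t, subset_hull ht, _, hq, by rw [toReal_sub, add_sub_cancel]⟩⟩
  have hSQ : hull S ⊆ hull (T : Set (Fin n → ℤ)) + Q := hull_subset_of_convex (hconv _) hT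
  have hTne : T.Nonempty := by
    obtain ⟨s, hs⟩ := hne
    obtain ⟨h, hh, -⟩ := hT s hs
    obtain ⟨_, t, ht, -⟩ : (toReal '' (T : Set (Fin n → ℤ))).Nonempty :=
      (convexHull_nonempty_iff (𝕜 := ℝ)).1 ⟨h, hh⟩
    exact ⟨t, ht⟩
  obtain ⟨t, ht⟩ := hTne
  have hred : ∀ h ∈ hull (T.erase t : Set (Fin n → ℤ)), toReal t - h ∉ Q := fun h hh hq => by
    refine hmin (T.erase t) ⟨fun t' ht' => hTS t' (Finset.mem_of_mem_erase ht'), fun s hs => ?_⟩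
      (Finset.erase_ssubset ht)
    obtain ⟨h', hh', q, hq', hs'⟩ := hT s hs
    have : hull (T : Set (Fin n → ℤ)) ⊆ hull (T.erase t : Set (Fin n → ℤ)) + Q := by
      refine hull_subset_of_convex (hconv _) fun z hz => ?_
      by_cases hzt : z = t
      · exact Set.mem_add.2 ⟨h, hh, _, hq, by rw [hzt, add_sub_cancel]⟩
      · exact ⟨toReal z, subset_hull (Finset.mem_coe.2 (Finset.mem_erase.2 ⟨hzt, hz⟩)), 0, h0,
          add_zero _⟩
    obtain ⟨h'', hh'', q', hq'', e⟩ := this hh'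
    refine ⟨h'', hh'', q' + q, hadd _ hq'' _ hq', ?_⟩
    rw [← hs', ← e]
    exact (add_assoc _ _ _).symm
  refine ⟨t, hTS t ht, fun v d hv hp hm => ?_⟩
  obtain ⟨h₁, hh₁, q₁, hq₁, e₁⟩ := hSQ hp
  obtain ⟨h₂, hh₂, q₂, hq₂, e₂⟩ := hSQ hm
  have e₁ : h₁ + q₁ = toReal t + v + d := e₁
  have e₂ : h₂ + q₂ = toReal t + v - d := e₂
  have key : h₁ = toReal t ∧ h₂ = toReal t := by
    rw [← Finset.insert_erase ht, Finset.coe_insert] at hh₁ hh₂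
    rcases (T.erase t).eq_empty_or_nonempty with hE | hE
    · rw [hE] at hh₁ hh₂
      simpa [hull] using And.intro hh₁ hh₂
    · obtain ⟨p₁, hp₁, a₁, ha₁, rfl⟩ := hull_insert (Finset.coe_nonempty.2 hE) hh₁
      obtain ⟨p₂, hp₂, a₂, ha₂, rfl⟩ := hull_insert (Finset.coe_nonempty.2 hE) hh₂
      rcases (add_nonneg ha₁ ha₂).eq_or_lt with h | h
      · have z₁ : a₁ = 0 := by linarith
        have z₂ : a₂ = 0 := by linarith
        simp [z₁, z₂]
      · exfalso
        -- Let `p` be this weighted mean. Adding `e₁` and `e₂` gives `(a₁ + a₂)(t - p) = q₁ + q₂ -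
        -- 2v`, which lies in `Q`, against the minimality of `T`.
        refine hred ((a₁ / (a₁ + a₂)) • p₁ + (a₂ / (a₁ + a₂)) • p₂)
          (convex_hull _ hp₁ hp₂ (by positivity) (by positivity) (by field_simp)) ?_
        have hq : (a₁ + a₂)⁻¹ • ((q₁ + q₂) + (2 : ℝ) • -v) ∈ Q :=
          hsmul _ (hadd _ (hadd _ hq₁ _ hq₂) _ (hsmul _ hv 2 (by norm_num))) _ (by positivity)
        convert hq using 1
        ext i
        have c₁ := congrFun e₁ i
        have c₂ := congrFun e₂ i
        simp only [Pi.add_apply, Pi.sub_apply, Pi.smul_apply, Pi.neg_apply, smul_eq_mul] at *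
        field_simp
        linarith
  rw [key.1] at e₁
  rw [key.2] at e₂
  constructor
  · convert hadd _ hq₁ _ hv using 1
    rw [add_assoc] at e₁
    rw [add_left_cancel e₁]
    abel
  · convert hadd _ hq₂ _ hv using 1
    rw [add_sub_assoc] at e₂
    rw [add_left_cancel e₂]
    abel

/-! ### Integrality of vertices and integral convexity of the cone -/

/-- Around a point of the hull, the directions to the points of a local convex combination are
feasible in both orientations. -/
theorem IsIntegrallyConvex.exists_two_sided_direction {S : Set (Fin n → ℤ)}
    (hS : IsIntegrallyConvex S) {p : Fin n → ℝ} (hp : p ∈ hull S) :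
    ∃ y ∈ S ∩ integralNeighborhood p, ∃ ε : ℝ, 0 < ε ∧
      p + ε • (toReal y - p) ∈ hull S ∧ p - ε • (toReal y - p) ∈ hull S := by
  classical
  obtain ⟨F, w, hF, hw0, hw1, hw⟩ := exists_weights_of_mem_hull (hS.mem_local hp)
  have hne : F.Nonempty := by
    by_contra h
    rw [Finset.not_nonempty_iff_eq_empty] at h
    simp [h] at hw1
  obtain ⟨y, hy⟩ := hne
  refine ⟨y, hF y hy, w y, hw0 y hy, ?_, ?_⟩
  · refine (convex_hull S).add_smul_sub_mem hp (subset_hull (hF y hy).1) ⟨(hw0 y hy).le, ?_⟩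
    rw [← hw1]
    exact Finset.single_le_sum (fun z hz => (hw0 z hz).le) hy
  -- Replacing `y` by `p` in the combination moves its value from `p` to `p + w y • (p - y)`.
  · have : ∑ z ∈ F, w z • (if z = y then p else toReal z) ∈ hull S :=
      (convex_hull S).sum_mem (fun z hz => (hw0 z hz).le) hw1 fun z hz => by
        split_ifs
        · exact hp
        · exact subset_hull (hF z hz).1
    convert this using 1
    rw [← Finset.add_sum_erase F _ hy] at hw ⊢
    rw [if_pos rfl, Finset.sum_congr rfl fun z hz => by rw [if_neg (Finset.ne_of_mem_erase hz)],
      eq_sub_iff_add_eq'.2 hw, smul_sub]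
    abel

/-- Vertices of the intersection of the characteristic cone with an integral box are integral. -/
theorem IsIntegrallyConvex.integral_of_mem_extremePoints {S : Set (Fin n → ℤ)}
    (hS : IsIntegrallyConvex S) {l u : Fin n → ℤ} {v : Fin n → ℝ}
    (hv : v ∈ (charCone (hull S) ∩ integralBox l u).extremePoints ℝ) : ∃ z, toReal z = v := by
  obtain ⟨⟨hvC, hvB⟩, hext⟩ := mem_extremePoints.1 hv
  obtain ⟨T, hTS, hT⟩ := hS.exists_finset_cover
  set C := charCone (hull S)
  have hsm : ∀ c ∈ C, ∀ r : ℝ, 0 ≤ r → r • c ∈ C :=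
    fun c hc r hr => smul_mem_charCone (convex_hull S) hc hr
  -- `Q` is `C - ℝ₊v`: it contains `C` and `-v`.
  obtain ⟨t, ht, h⟩ := exists_extreme_modulo_cone hS.1
    (Q := {q | ∃ r : ℝ, 0 ≤ r ∧ q + r • v ∈ C}) ⟨0, le_rfl, by simpa using zero_mem_charCone _⟩
    (by
      rintro q ⟨r, hr, hq⟩ q' ⟨r', hr', hq'⟩
      refine ⟨r + r', add_nonneg hr hr', ?_⟩
      convert add_mem_charCone hq hq' using 1
      module)
    (by
      rintro q ⟨r, hr, hq⟩ a ha
      refine ⟨a * r, mul_nonneg ha hr, ?_⟩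
      convert hsm _ hq a ha using 1
      module) hTS
    (fun s hs => by
      obtain ⟨t, ht, hst⟩ := hT s hs
      exact ⟨t, ht, 0, le_rfl, by simpa using hst⟩)
  obtain ⟨y, ⟨hyS, hyN⟩, ε, hε, hp, hm⟩ :=
    hS.exists_two_sided_direction (hvC _ (subset_hull ht))
  set d := toReal y - (toReal t + v) with hd
  obtain ⟨⟨r, hr, h₁⟩, r', hr', h₂⟩ := h v (ε • d)
    ⟨1, zero_le_one, by simpa using zero_mem_charCone _⟩ hp hm
  -- Adding multiples of `v` brings its coefficient to `R` in both memberships; dividing by `R`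
  -- leaves exactly `v ± (ε / R) d`.
  set R := r + r' + 1
  have hR : 0 < R := by positivity
  have hC : ∀ a : ℝ, 0 ≤ a → a ≤ ε / R → v + a • d ∈ C ∧ v - a • d ∈ C := fun a ha haR => by
    have g₁ : v + (R⁻¹ * ε) • d ∈ C := by
      convert hsm _ (add_mem_charCone h₁ (hsm v hvC (r' + 1) (by positivity))) R⁻¹
        (by positivity) using 1
      have : ε • d + r • v + (r' + 1) • v = ε • d + R • v := by simp only [R]; module
      rw [this, smul_add, smul_smul, smul_smul, inv_mul_cancel₀ hR.ne', one_smul, add_comm]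
    have g₂ : v - (R⁻¹ * ε) • d ∈ C := by
      convert hsm _ (add_mem_charCone h₂ (hsm v hvC (r + 1) (by positivity))) R⁻¹
        (by positivity) using 1
      have : -(ε • d) + r' • v + (r + 1) • v = -(ε • d) + R • v := by simp only [R]; module
      rw [this, smul_add, smul_neg, smul_smul, smul_smul, inv_mul_cancel₀ hR.ne', one_smul]
      abel
    have ht : a / (R⁻¹ * ε) ∈ Set.Icc (0 : ℝ) 1 :=
      ⟨by positivity, (div_le_one (by positivity)).2 (by rwa [inv_mul_eq_div])⟩
    have hne : R⁻¹ * ε ≠ 0 := by positivity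
    have k₁ := (convex_charCone (convex_hull S)).add_smul_mem hvC g₁ ht
    rw [sub_eq_add_neg] at g₂
    have k₂ := (convex_charCone (convex_hull S)).add_smul_mem hvC g₂ ht
    rw [smul_neg, ← sub_eq_add_neg] at k₂
    rw [smul_smul, div_mul_cancel₀ _ hne] at k₁ k₂
    exact ⟨k₁, k₂⟩
  have hB : ∀ᶠ a : ℝ in nhdsWithin 0 (Set.Ioi 0), ∀ i,
      ((l i : ℝ) ≤ v i + a * d i ∧ v i + a * d i ≤ u i) ∧
        ((l i : ℝ) ≤ v i - a * d i ∧ v i - a * d i ≤ u i) := by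
    rw [Filter.eventually_all]
    intro i
    have hl : (l i : ℝ) ≤ v i := hvB.1 i
    have hu : v i ≤ u i := hvB.2 i
    -- If `v i` is an integer, so is `t i + v i`, and locality forces `d i = 0`. Otherwise both box
    -- bounds are strict and small moves are harmless.
    by_cases hi : ∃ k : ℤ, v i = k
    · obtain ⟨k, hk⟩ := hi
      have hdi : d i = 0 := by
        have := hyN i
        simp only [Pi.add_apply, toReal_apply, hk] at this
        have : |t i + k - y i| < 1 := by exact_mod_cast this
        rw [abs_lt] at this
        have : y i = t i + k := by omega
        simp [hd, toReal_apply, hk, this]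
      simp [hdi, hl, hu]
    · have hl : (l i : ℝ) < v i := hl.lt_of_ne fun h => hi ⟨_, h.symm⟩
      have hu : v i < u i := hu.lt_of_ne fun h => hi ⟨_, h⟩
      have c₁ : Filter.Tendsto (fun a : ℝ => v i + a * d i) (nhds 0) (nhds (v i)) := by
        have : Continuous fun a : ℝ => v i + a * d i := by fun_prop
        simpa using this.tendsto 0
      have c₂ : Filter.Tendsto (fun a : ℝ => v i - a * d i) (nhds 0) (nhds (v i)) := by
        have : Continuous fun a : ℝ => v i - a * d i := by fun_prop
        simpa using this.tendsto 0
      refine Filter.Eventually.filter_mono nhdsWithin_le_nhds ?_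
      filter_upwards [c₁ (Icc_mem_nhds hl hu), c₂ (Icc_mem_nhds hl hu)] with a h₁ h₂
      exact ⟨h₁, h₂⟩
  have hR' : ∀ᶠ a : ℝ in nhdsWithin 0 (Set.Ioi 0), a ∈ Set.Ioc 0 (ε / R) :=
    Ioc_mem_nhdsGT (by positivity)
  obtain ⟨a, hBa, ha0, haR⟩ := (hB.and hR').exists
  have hCa := hC a ha0.le haR
  have hseg : v ∈ openSegment ℝ (v + a • d) (v - a • d) :=
    ⟨1 / 2, 1 / 2, by norm_num, by norm_num, by norm_num, by module⟩
  have := (hext _ ⟨hCa.1, fun i => (hBa i).1.1, fun i => (hBa i).1.2⟩ _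
    ⟨hCa.2, fun i => (hBa i).2.1, fun i => (hBa i).2.2⟩ hseg).1
  have hd0 : d = 0 := by
    rw [add_eq_left, smul_eq_zero] at this
    exact this.resolve_left ha0.ne'
  refine ⟨y - t, ?_⟩
  rw [toReal_sub, sub_eq_iff_eq_add', ← sub_eq_zero]
  exact hd0

/-- The integer points of the characteristic cone of an integrally convex set form an integrally
convex set. -/
theorem IsIntegrallyConvex.integerPoints_charCone {S : Set (Fin n → ℤ)}
    (hS : IsIntegrallyConvex S) : IsIntegrallyConvex (integerPoints (charCone (hull S))) := by
  refine isIntegrallyConvex_of_local ⟨0, ?_⟩ fun x hx => ?_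
  · change toReal 0 ∈ charCone (hull S)
    rw [toReal_zero]
    exact zero_mem_charCone _
  have hxC : x ∈ charCone (hull S) :=
    hull_subset_of_convex (convex_charCone (convex_hull S)) (fun z hz => hz) hx
  -- The integer points of this box all lie in `N(x)`, so integral vertices give a local
  -- representation of `x`.
  set l : Fin n → ℤ := fun i => ⌊x i⌋
  set u : Fin n → ℤ := fun i => ⌈x i⌉
  have hxB : x ∈ integralBox l u := ⟨fun i => Int.floor_le _, fun i => Int.le_ceil _⟩
  have hN : ∀ z, toReal z ∈ integralBox l u → z ∈ integralNeighborhood x := fun z hz i => by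
    have h₁ : (⌊x i⌋ : ℝ) ≤ z i := hz.1 i
    have h₂ : (z i : ℝ) ≤ ⌈x i⌉ := hz.2 i
    have := Int.lt_floor_add_one (x i)
    have := Int.ceil_lt_add_one (x i)
    rw [abs_lt]
    constructor <;> linarith
  have hcpt : IsCompact (charCone (hull S) ∩ integralBox l u) :=
    isCompact_Icc.inter_left (isClosed_charCone hS.isClosed_hull)
  have hcvx : Convex ℝ (charCone (hull S) ∩ integralBox l u) :=
    (convex_charCone (convex_hull S)).inter (convex_Icc _ _)
  have hxK : x ∈ charCone (hull S) ∩ integralBox l u := ⟨hxC, hxB⟩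
  rw [← closure_convexHull_extremePoints hcpt hcvx] at hxK
  have hfin : (integerPoints (charCone (hull S)) ∩ integralNeighborhood x).Finite := by
    refine (Set.finite_Icc l u).subset fun z hz => ?_
    rw [← integerPoints_box_eq]
    exact mem_box_of_mem_integralNeighborhood hxB hz.2
  refine closure_minimal (convexHull_mono fun v hv => ?_)
    (Set.Finite.isClosed_convexHull ℝ (hfin.image toReal)) hxK
  obtain ⟨z, rfl⟩ := hS.integral_of_mem_extremePoints hv
  exact ⟨z, ⟨hv.1.1, hN z hv.1.2⟩, rfl⟩

end IntegralConvexity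

theorem theorem3 (n : ℕ) (S : Set (Fin n → ℤ))
    (hS : IntegralConvexity.IsIntegrallyConvex S) :
    ∃ T G : Set (Fin n → ℤ),
      S = T + G ∧
      Bornology.IsBounded T ∧
      IntegralConvexity.IsIntegrallyConvex T ∧
      IntegralConvexity.IsIntegrallyConvex G ∧
      IntegralConvexity.IsConic G ∧
      G = IntegralConvexity.integerPoints
            (IntegralConvexity.charCone (IntegralConvexity.hull S)) ∧
      ∃ l u : Fin n → ℤ, l ≤ u ∧
        T = S ∩ IntegralConvexity.integerPoints (IntegralConvexity.integralBox l u) := by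
  open IntegralConvexity in
  obtain ⟨T, hTS, hT⟩ := hS.exists_finset_cover
  obtain ⟨l, hl⟩ := T.finite_toSet.bddBelow
  obtain ⟨u, hu⟩ := T.finite_toSet.bddAbove
  have hTbox : ∀ t ∈ T, t ∈ S ∩ integerPoints (integralBox l u) := fun t ht =>
    ⟨hTS t ht, by
      rw [integerPoints_box_eq]
      exact ⟨hl ht, hu ht⟩⟩
  obtain ⟨s, hs⟩ := hS.1
  obtain ⟨t, ht, -⟩ := hT s hs
  refine ⟨S ∩ integerPoints (integralBox l u), integerPoints (charCone (hull S)), ?_, ?_,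
    hS.inter_box ⟨t, hTbox t ht⟩, hS.integerPoints_charCone, isConic_integerPoints_charCone _,
    rfl, l, u, (hl ht).trans (hu ht), rfl⟩
  · refine Set.Subset.antisymm (fun s hs => ?_) ?_
    · obtain ⟨t, ht, hst⟩ := hT s hs
      exact ⟨t, hTbox t ht, s - t, hst, add_sub_cancel _ _⟩
    · rintro _ ⟨t, ht, g, hg, rfl⟩
      refine hS.mem_of_toReal_mem_hull ?_
      change toReal (t + g) ∈ hull S
      rw [toReal_add]
      exact hg _ (subset_hull ht.1)
  · rw [integerPoints_box_eq]
    exact ((Set.finite_Icc l u).inter_of_right S).isBounded
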